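/- Let $A$ and $Q$ be finitely generated abelian groups, and let $A\wr Q=\bigl(\bigoplus_{q\in Q}A\bigr)\rtimes Q$ be their restricted wreath product, where $Q$ acts on the direct sum by translating coordinates. Then $A\wr Q$ is LERF; that is, $A\wr Q$ is finitely generated and every finitely generated subgroup $S$ of $A\wr Q$ is closed in the profinite topology of $A\wr Q$ (the topology for which the cosets of the normal subgroups of finite index form a base). -/

import Mathlib

/-- The restricted (regular) wreath product `A ≀ Q`: the elements of the unrestricted regular wreath
product `(Q → A) ⋊ Q` whose `Q → A` part has finite support. -/
def restrictedWreathProduct (A Q : Type*) [Group A] [Group Q] : Subgroup (A ≀ᵣ Q) where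
  carrier := {x | (Function.mulSupport x.left).Finite}
  one_mem' := by
    simp
  mul_mem' := by
    intro a b ha hb
    simp only [Set.mem_ofPred_eq] at ha hb ⊢
    refine (ha.union (hb.image fun x => a.right * x)).subset ?_
    intro x hx
    by_contra h
    simp only [Set.mem_union, Set.mem_image, Function.mem_mulSupport, not_or, not_not,
      not_exists, not_and] at h
    have h2 : b.left (a.right⁻¹ * x) = 1 := by
      by_contra hne
      exact h.2 _ hne (by group)
    exact hx (by simp [h.1, h2])
  inv_mem' := by
    intro a ha
    simp only [Set.mem_ofPred_eq] at ha ⊢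
    refine (ha.image fun x => a.right⁻¹ * x).subset ?_
    intro x hx
    exact ⟨a.right * x, fun h => hx (by simp [h]), by group⟩

/-- The profinite topology of a group: the cosets of the normal subgroups of finite index form a
base. -/
abbrev profiniteTopology (G : Type*) [Group G] : TopologicalSpace G where
  IsOpen U := ∀ g ∈ U, ∃ N : Subgroup G, N.Normal ∧ N.FiniteIndex ∧ ∀ n ∈ N, g * n ∈ U
  isOpen_univ := fun _ _ => ⟨⊤, inferInstance, inferInstance, fun _ _ => trivial⟩
  isOpen_inter := by
    intro U V hU hV g hg
    obtain ⟨N, hN, hN', h⟩ := hU g hg.1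
    obtain ⟨M, hM, hM', h'⟩ := hV g hg.2
    exact ⟨N ⊓ M, inferInstance, inferInstance, fun n hn => ⟨h n hn.1, h' n hn.2⟩⟩
  isOpen_sUnion := by
    intro s hs g hg
    obtain ⟨U, hU, hgU⟩ := hg
    obtain ⟨N, hN, hN', h⟩ := hs U hU g hgU
    exact ⟨N, hN, hN', fun n hn => ⟨U, hU, h n hn⟩⟩

/-- A subgroup is separable if it is closed in the profinite topology of the ambient group. -/
def IsSeparableSubgroup {G : Type*} [Group G] (S : Subgroup G) : Prop :=
  @IsClosed G (profiniteTopology G) (S : Set G)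

/-- A group is LERF if it is finitely generated and all its finitely generated subgroups are
separable. -/
structure IsLERF (G : Type*) [Group G] : Prop where
  fg : Group.FG G
  separable : ∀ S : Subgroup G, S.FG → IsSeparableSubgroup S

/-! Let `T` be the projection of `S` to `Q`, and let `g ∉ S`. If `g` projects outside `T`, a
finite-index subgroup of `Q` already separates; otherwise, dividing `g` by an element of `S` gives
some `m ∉ S` in the base group. Since `S` is finitely generated, all its base components, and that
of `m`, live on a set `Y` made of finitely many cosets of `T`. Choose `C` with `T ∩ C = 1`, with
`TC` of finite index, and small enough that `Q → Q ⧸ C` is injective on `Y`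
(`Subgroup.exists_disjoint_finiteIndex_sup`). Summing over cosets of `C` then loses nothing about
`S` and `m`, while the target `⨁_{Q ⧸ C} A` becomes a finitely generated `ℤ[T]`-module. The base
elements of `S` map to a submodule `N` missing the image of `m`. Krull's intersection theorem and
the Nullstellensatz over `ℤ` give a finite-index submodule `L ≥ N` still missing it
(`Submodule.exists_finite_quotient_notMem`). Enlarging `S` by `C` and `L` (`thickening`) yields the
required finite-index subgroup. -/

/-! ### Finite quotients of modules over finitely generated commutative rings -/

theorem isJacobsonRing_int : IsJacobsonRing ℤ := by
  rw [isJacobsonRing_iff_prime_eq]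
  intro P hP
  by_cases h : P = ⊥
  · subst h
    rw [eq_bot_iff]
    intro x hx
    -- The membership criterion makes `x * y + 1` a unit for every `y`; with `y = x`, the equation
    -- `x² + 1 = ±1` forces `x = 0`.
    have h1 : IsUnit (x * x + 1) := Ideal.mem_jacobson_bot.1 hx x
    rcases Int.isUnit_iff.1 h1 with h2 | h2
    · have : x * x = 0 := by linarith
      simpa using this
    · nlinarith [mul_self_nonneg x]
  · have := IsPrime.to_maximal_ideal h
    exact Ideal.jacobson_eq_self_of_isMaximal

/-- A field that is finitely generated as a ring is finite. -/
theorem finite_of_finiteType_int (K : Type*) [Field K] [inst : Algebra ℤ K]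
    [Algebra.FiniteType ℤ K] : Finite K := by
  obtain rfl : inst = Ring.toIntAlgebra K := Subsingleton.elim _ _
  have := isJacobsonRing_int
  have hfin : Module.Finite ℤ K := finite_of_finite_type_of_isJacobsonRing ℤ K
  by_cases hinj : Function.Injective (algebraMap ℤ K)
  · have : Algebra.IsIntegral ℤ K := inferInstance
    exact absurd (isField_of_isIntegral_of_isField hinj (Field.toIsField K)) Int.not_isField
  · rw [injective_iff_map_eq_zero] at hinj
    push Not at hinj
    obtain ⟨n, hn, hn0⟩ := hinj
    refine Module.finite_of_fg_torsion K fun x => ⟨⟨n, mem_nonZeroDivisors_of_ne_zero hn0⟩, ?_⟩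
    change n • x = 0
    rw [Algebra.smul_def, hn, zero_mul]

/-- Finitely generated modules over finitely generated commutative rings are residually finite,
with every submodule closed. -/
theorem Submodule.exists_finite_quotient_notMem {R M : Type*} [CommRing R] [Algebra ℤ R]
    [Algebra.FiniteType ℤ R] [AddCommGroup M] [Module R M] [Module.Finite R M]
    (N : Submodule R M) {m : M} (hm : m ∉ N) :
    ∃ L : Submodule R M, N ≤ L ∧ m ∉ L ∧ Finite (M ⧸ L) := by
  have : IsNoetherianRing R := Algebra.FiniteType.isNoetherianRing ℤ R
  set x : M ⧸ N := N.mkQ m with hx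
  have hx0 : x ≠ 0 := by simpa [hx] using hm
  have htop : Ideal.torsionOf R (M ⧸ N) x ≠ ⊤ := by
    rwa [Ne, Ideal.torsionOf_eq_top_iff]
  obtain ⟨P, hP, hle⟩ := Ideal.exists_le_maximal _ htop
  -- Krull: otherwise `r • x = x` for some `r ∈ P`, so `1 - r` annihilates `x` and lies in `P`,
  -- whence `1 ∈ P`.
  have hnot : x ∉ (⨅ i : ℕ, P ^ i • ⊤ : Submodule R (M ⧸ N)) := by
    rw [Ideal.mem_iInf_smul_pow_eq_bot_iff]
    rintro ⟨r, hr⟩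
    have h1 : 1 - (r : R) ∈ P := hle (by simp [Ideal.mem_torsionOf_iff, sub_smul, hr])
    exact hP.ne_top ((Ideal.eq_top_iff_one P).2 (by simpa using P.add_mem h1 r.2))
  rw [Submodule.mem_iInf, not_forall] at hnot
  obtain ⟨n, hn⟩ := hnot
  let := Ideal.Quotient.field P
  have hfinP : Finite (R ⧸ P) := finite_of_finiteType_int (R ⧸ P)
  have hfinPn : Finite (R ⧸ P ^ n) := Ideal.finite_quotient_pow (IsNoetherian.noetherian P) n
  set K : Submodule R (M ⧸ N) := P ^ n • ⊤ with hK
  have hfinK : Finite ((M ⧸ N) ⧸ K) := Module.finite_of_finite (R ⧸ P ^ n)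
  refine ⟨K.comap N.mkQ, fun y hy => ?_, hn, ?_⟩
  · rw [Submodule.mem_comap, Submodule.mkQ_apply, (Submodule.Quotient.mk_eq_zero N).2 hy]
    exact K.zero_mem
  · refine Finite.of_injective (Submodule.mapQ (K.comap N.mkQ) K N.mkQ le_rfl) ?_
    rw [← LinearMap.ker_eq_bot, Submodule.ker_mapQ]
    simp

open scoped MonoidAlgebra in
/-- Invariant subgroups of a finitely generated module over `ℤ[T]`, where `T` is a finitely
generated abelian group, are intersections of invariant subgroups of finite index. -/
theorem Representation.exists_invariant_finiteIndex_notMem {T V : Type*} [CommGroup T] [Group.FG T]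
    [AddCommGroup V] (ρ : Representation ℤ T V) {s : Set V} (hs : s.Finite)
    (hgen : ∀ W : AddSubgroup V, (∀ t, ∀ w ∈ W, ρ t w ∈ W) → s ⊆ W → W = ⊤)
    (N : AddSubgroup V) (hN : ∀ t, ∀ w ∈ N, ρ t w ∈ N) {v : V} (hv : v ∉ N) :
    ∃ L : AddSubgroup V, N ≤ L ∧ v ∉ L ∧ Finite (V ⧸ L) ∧ ∀ t, ∀ w ∈ L, ρ t w ∈ L := by
  have hft : Algebra.FiniteType ℤ ℤ[T] := inferInstance
  have hsmul : ∀ (L : Submodule ℤ[T] ρ.asModule) (t : T) (w : ρ.asModule), w ∈ L →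
      (ρ t w : V) ∈ L.toAddSubgroup := by
    intro L t w hw
    have := L.smul_mem (MonoidAlgebra.of ℤ T t) hw
    rwa [MonoidAlgebra.of_apply, Representation.single_smul, one_smul] at this
  let N' : Submodule ℤ[T] ρ.asModule :=
    { N with
      smul_mem' := by
        intro r w hw
        induction r using MonoidAlgebra.induction_linear with
        | zero => rw [zero_smul]; exact N.zero_mem
        | add a b ha hb => rw [add_smul]; exact N.add_mem ha hb
        | single t n =>
          rw [Representation.single_smul]
          exact N.zsmul_mem (hN t w hw) n }
  have hfin : Module.Finite ℤ[T] ρ.asModule := by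
    refine ⟨Submodule.fg_def.2 ⟨s, hs, ?_⟩⟩
    have := hgen (Submodule.span ℤ[T] (M := ρ.asModule) s).toAddSubgroup (hsmul _)
      (Submodule.subset_span (R := ℤ[T]) (M := ρ.asModule))
    rw [eq_top_iff]
    intro x _
    have hx : x ∈ (⊤ : AddSubgroup V) := AddSubgroup.mem_top x
    rw [← this] at hx
    exact hx
  obtain ⟨L, hNL, hvL, hL⟩ := N'.exists_finite_quotient_notMem (m := (v : ρ.asModule)) hv
  exact ⟨L.toAddSubgroup, hNL, hvL, hL, hsmul L⟩

/-! ### Almost complements in finitely generated abelian groups -/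

theorem Subgroup.exists_finiteIndex_notMem {Q : Type*} [CommGroup Q] [Group.FG Q]
    (T : Subgroup Q) {e : Q} (he : e ∉ T) :
    ∃ U : Subgroup Q, T ≤ U ∧ e ∉ U ∧ U.FiniteIndex := by
  have : Module.Finite ℤ (Additive Q) := Module.Finite.iff_addGroup_fg.2 inferInstance
  obtain ⟨L, hTL, heL, hL⟩ := Submodule.exists_finite_quotient_notMem
    (AddSubgroup.toIntSubmodule T.toAddSubgroup) (m := Additive.ofMul e) he
  refine ⟨L.toAddSubgroup.toSubgroup', hTL, heL, ?_⟩
  have : Finite (Q ⧸ L.toAddSubgroup.toSubgroup') := hL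
  exact Subgroup.finiteIndex_of_finite_quotient

theorem Subgroup.exists_finiteIndex_forall_notMem {Q : Type*} [CommGroup Q] [Group.FG Q]
    (T : Subgroup Q) {E : Set Q} (hE : E.Finite) :
    ∃ U : Subgroup Q, T ≤ U ∧ (∀ e ∈ E, e ∈ U → e ∈ T) ∧ U.FiniteIndex := by
  induction E, hE using Set.Finite.induction_on with
  | empty => exact ⟨⊤, le_top, by simp, inferInstance⟩
  | @insert a E _ _ ih =>
    obtain ⟨U, hTU, hU, hfin⟩ := ih
    by_cases ha : a ∈ T
    · refine ⟨U, hTU, ?_, hfin⟩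
      rintro e (rfl | he) h
      exacts [ha, hU e he h]
    · obtain ⟨W, hTW, haW, hW⟩ := T.exists_finiteIndex_notMem ha
      refine ⟨U ⊓ W, le_inf hTU hTW, ?_, inferInstance⟩
      rintro e (rfl | he) h
      exacts [absurd h.2 haW, hU e he h.1]

/-- A subgroup `T` of a finitely generated abelian group has an almost complement `C`, which can be
chosen so that `T ⊔ C` meets a given finite set only inside `T`. -/
theorem Subgroup.exists_disjoint_finiteIndex_sup {Q : Type*} [CommGroup Q] [Group.FG Q]
    (T : Subgroup Q) {E : Set Q} (hE : E.Finite) :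
    ∃ C : Subgroup Q, Disjoint T C ∧ (T ⊔ C).FiniteIndex ∧ ∀ e ∈ E, e ∈ T ⊔ C → e ∈ T := by
  obtain ⟨U, hTU, hU, hfin⟩ := T.exists_finiteIndex_forall_notMem hE
  -- Maximality of `C` makes `Q ⧸ (T ⊔ C)` torsion; keeping `C` inside `U` controls the intersection
  -- with `E`.
  obtain ⟨C, -, hC⟩ := zorn_le_nonempty₀ {C : Subgroup Q | C ≤ U ∧ Disjoint T C} (by
    intro c hc hchain y hy
    refine ⟨sSup c, ⟨sSup_le fun D hD => (hc hD).1, ?_⟩, fun D hD => le_sSup hD⟩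
    rw [Subgroup.disjoint_def]
    intro x hxT hx
    rw [Subgroup.mem_sSup_of_directedOn ⟨y, hy⟩ hchain.directedOn] at hx
    obtain ⟨D, hD, hxD⟩ := hx
    exact Subgroup.disjoint_def.1 (hc hD).2 hxT hxD) ⊥ ⟨bot_le, disjoint_bot_right⟩
  refine ⟨C, hC.prop.2, ?_, fun e he h => hU e he (sup_le hTU hC.prop.1 h)⟩
  have htors : IsMulTorsion (Q ⧸ (T ⊔ C)) := by
    intro x
    obtain ⟨q, rfl⟩ := QuotientGroup.mk_surjective x
    rw [isOfFinOrder_iff_pow_eq_one]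
    set k := U.index with hk
    have hk0 : 0 < k := Nat.pos_of_ne_zero hfin.index_ne_zero
    have hqk : q ^ k ∈ U := U.pow_index_mem q
    suffices ∃ n : ℤ, n ≠ 0 ∧ (q ^ k) ^ n ∈ T ⊔ C by
      obtain ⟨n, hn, hmem⟩ := this
      refine ⟨k * n.natAbs, Nat.mul_pos hk0 (Int.natAbs_pos.2 hn), ?_⟩
      rw [← QuotientGroup.mk_pow, QuotientGroup.eq_one_iff, pow_mul, ← zpow_natCast]
      rcases abs_choice n with h | h <;> rw [Int.natCast_natAbs, h]
      · exact hmem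
      · rw [zpow_neg]
        exact inv_mem hmem
    by_contra! hno
    -- If no nonzero power of `q ^ k` lies in `T ⊔ C`, adjoining `q ^ k` to `C` keeps it disjoint
    -- from `T`, against maximality.
    have hmem : C ⊔ Subgroup.zpowers (q ^ k) ∈ {C : Subgroup Q | C ≤ U ∧ Disjoint T C} := by
      refine ⟨sup_le hC.prop.1 (by simpa using hqk), Subgroup.disjoint_def.2 ?_⟩
      intro x hxT hx
      obtain ⟨c, hc, z, hz, rfl⟩ := Subgroup.mem_sup.1 hx
      obtain ⟨n, rfl⟩ := Subgroup.mem_zpowers_iff.1 hz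
      have hn : n = 0 := by
        by_contra hn
        refine hno n hn ?_
        have := Subgroup.mul_mem_sup hxT (C.inv_mem hc)
        rwa [mul_right_comm, mul_inv_cancel, one_mul] at this
      subst hn
      rw [zpow_zero, mul_one] at hxT ⊢
      exact Subgroup.disjoint_def.1 hC.prop.2 hxT hc
    have hle : C ⊔ Subgroup.zpowers (q ^ k) ≤ C := hC.le_of_ge hmem le_sup_left
    refine hno 1 one_ne_zero (le_sup_right (a := T) (hle (le_sup_right (a := C) ?_)))
    rw [zpow_one]
    exact Subgroup.mem_zpowers _
  have : Finite (Q ⧸ (T ⊔ C)) := CommGroup.finite_of_fg_isMulTorsion _ htors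
  exact Subgroup.finiteIndex_of_finite_quotient

theorem Subgroup.FG.map_monoidHom {G H : Type*} [Group G] [Group H] {S : Subgroup G} (hS : S.FG)
    (f : G →* H) : (S.map f).FG := by
  obtain ⟨X, rfl, hX⟩ := (Subgroup.fg_iff S).1 hS
  exact (Subgroup.fg_iff _).2 ⟨f '' X, (MonoidHom.map_closure f X).symm, hX.image f⟩

/-- A subgroup is separable if every element outside it can be excluded by a subgroup of finite
index that contains it. -/
theorem IsSeparableSubgroup.of_forall_notMem {G : Type*} [Group G] {S : Subgroup G}
    (h : ∀ g ∉ S, ∃ H : Subgroup G, S ≤ H ∧ g ∉ H ∧ H.FiniteIndex) : IsSeparableSubgroup S := by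
  refine @IsClosed.mk G (profiniteTopology G) _ ?_
  intro g hg
  obtain ⟨H, hSH, hgH, hfin⟩ := h g hg
  refine ⟨H.normalCore, inferInstance, inferInstance, fun n hn hgn => hgH ?_⟩
  have := H.mul_mem (hSH hgn) (H.inv_mem (H.normalCore_le hn))
  rwa [mul_inv_cancel_right] at this

/-! ### Generators of the wreath product, and summation over cosets -/

namespace restrictedWreathProduct

section Group

variable {A Q : Type*} [Group A] [Group Q]

/-- The projection of the restricted wreath product onto the acting group. -/
def rightHom : restrictedWreathProduct A Q →* Q :=
  RegularWreathProduct.rightHom.comp (restrictedWreathProduct A Q).subtype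

/-- The embedding of the acting group into the restricted wreath product. -/
def inr : Q →* restrictedWreathProduct A Q where
  toFun q := ⟨RegularWreathProduct.inl q, by
    change (Function.mulSupport (RegularWreathProduct.inl q : A ≀ᵣ Q).left).Finite
    simp⟩
  map_one' := by ext1; simp
  map_mul' _ _ := by ext1; simp

theorem finiteIndex_comap_rightHom (U : Subgroup Q) [U.FiniteIndex] :
    (U.comap (rightHom (A := A))).FiniteIndex := by
  have hsurj : Function.Surjective (rightHom (A := A) (Q := Q)) := fun q => ⟨inr q, rfl⟩
  constructor
  rw [Subgroup.index_comap_of_surjective _ hsurj]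
  exact Subgroup.FiniteIndex.index_ne_zero

open Classical in
/-- The embedding of the base group at the identity coordinate. -/
noncomputable def single : A →* restrictedWreathProduct A Q where
  toFun a := ⟨⟨Pi.mulSingle 1 a, 1⟩, (Set.finite_singleton 1).subset Pi.mulSupport_mulSingle_subset⟩
  map_one' := by ext1; ext1 <;> simp
  map_mul' a b := by ext1; ext1 <;> simp [Pi.mulSingle_mul]

open Classical in
theorem inr_mul_single_mul_inr_inv (q : Q) (a : A) :
    ((inr q * single a * (inr q)⁻¹ : restrictedWreathProduct A Q) : A ≀ᵣ Q) =
      ⟨Pi.mulSingle q a, 1⟩ := by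
  ext x
  · simp [inr, single, Pi.mulSingle_apply, inv_mul_eq_one, eq_comm]
  · simp [inr, single]

/-- The restricted wreath product is generated by the two factors. -/
theorem range_single_sup_range_inr :
    (single (A := A) (Q := Q)).range ⊔ (inr (A := A) (Q := Q)).range = ⊤ := by
  classical
  set H := (single (A := A) (Q := Q)).range ⊔ (inr (A := A) (Q := Q)).range
  have hinr : ∀ q, inr q ∈ H := fun q => le_sup_right (a := single.range) ⟨q, rfl⟩
  have hsingle : ∀ a, single a ∈ H := fun a => le_sup_left (b := inr.range) ⟨a, rfl⟩
  have key : ∀ (E : Finset Q) (x : restrictedWreathProduct A Q),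
      Function.mulSupport x.1.left ⊆ E → x ∈ H := by
    intro E
    induction E using Finset.induction_on with
    | empty =>
      intro x hx
      have : x = inr x.1.right := by
        ext1
        ext q
        · change x.1.left q = 1
          by_contra h
          exact absurd (hx h) (by simp)
        · rfl
      rw [this]
      exact hinr _
    | insert e E he ih =>
      intro x hx
      set y : restrictedWreathProduct A Q := inr e * single (x.1.left e) * (inr e)⁻¹ with hy
      have hyH : y ∈ H := H.mul_mem (H.mul_mem (hinr _) (hsingle _)) (H.inv_mem (hinr _))
      have hyv : (y : A ≀ᵣ Q) = ⟨Pi.mulSingle e (x.1.left e), 1⟩ := inr_mul_single_mul_inr_inv _ _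
      rw [← H.mul_mem_cancel_left (H.inv_mem hyH)]
      refine ih _ fun q hq => ?_
      have hval : (y⁻¹ * x).1.left q = ((Pi.mulSingle e (x.1.left e) : Q → A) q)⁻¹ * x.1.left q := by
        simp [hyv]
      rw [Function.mem_mulSupport, hval] at hq
      by_cases hqe : q = e
      · subst hqe
        simp at hq
      · rw [Pi.mulSingle_eq_of_ne hqe, inv_one, one_mul] at hq
        exact (Finset.mem_insert.1 (hx hq)).resolve_left hqe
  rw [eq_top_iff]
  intro x _
  exact key (Set.Finite.toFinset x.2) x fun q hq => (Set.Finite.mem_toFinset _).2 hq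

theorem fg [hA : Group.FG A] [hQ : Group.FG Q] : Group.FG (restrictedWreathProduct A Q) := by
  rw [Group.fg_def, ← range_single_sup_range_inr, MonoidHom.range_eq_map, MonoidHom.range_eq_map]
  have hA' : (⊤ : Subgroup A).FG := Group.fg_def.1 hA
  have hQ' : (⊤ : Subgroup Q).FG := Group.fg_def.1 hQ
  exact (hA'.map_monoidHom _).sup (hQ'.map_monoidHom _)

end Group

section CommGroup

variable {A Q : Type*} [CommGroup A] [CommGroup Q]

/-- The base component of an element, as a finitely supported function. -/
noncomputable def toFinsupp (x : restrictedWreathProduct A Q) : Q →₀ Additive A :=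
  Finsupp.ofSupportFinite (fun q => Additive.ofMul (x.1.left q)) x.2

theorem toFinsupp_mul (x y : restrictedWreathProduct A Q) :
    toFinsupp (x * y) = toFinsupp x + Finsupp.mapDomain (x.1.right * ·) (toFinsupp y) := by
  ext q
  have h := Finsupp.mapDomain_apply (mul_right_injective x.1.right) (toFinsupp y) (x.1.right⁻¹ * q)
  rw [mul_inv_cancel_left] at h
  rw [Finsupp.add_apply, h]
  rfl

theorem ext_toFinsupp {x y : restrictedWreathProduct A Q} (h : toFinsupp x = toFinsupp y)
    (hr : rightHom x = rightHom y) : x = y := by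
  ext1
  ext q
  · exact DFunLike.congr_fun h q
  · exact hr

variable (C : Subgroup Q)

variable (A) in
/-- The action of `Q` by translation on the finitely supported functions on `Q ⧸ C`. -/
noncomputable def translation : Representation ℤ Q ((Q ⧸ C) →₀ Additive A) where
  toFun q := Finsupp.lmapDomain (Additive A) ℤ (q • ·)
  map_one' := by
    simp only [one_smul]
    exact Finsupp.lmapDomain_id _ _
  map_mul' p q := by
    simp only [mul_smul]
    exact Finsupp.lmapDomain_comp _ _ _ _

theorem translation_apply (q : Q) (v : (Q ⧸ C) →₀ Additive A) :
    translation A C q v = Finsupp.mapDomain (q • ·) v := rfl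

/-- As `Q` is abelian, `C` acts trivially on `Q ⧸ C`. -/
theorem translation_of_mem {c : Q} (hc : c ∈ C) : translation A C c = 1 := by
  have : (fun p : Q ⧸ C => c • p) = id := by
    funext p
    obtain ⟨q, rfl⟩ := QuotientGroup.mk_surjective p
    rw [id, MulAction.Quotient.smul_mk, smul_eq_mul, mul_comm, QuotientGroup.mk_mul_of_mem q hc]
  refine LinearMap.ext fun v => ?_
  rw [translation_apply, this, Finsupp.mapDomain_id]
  rfl

/-- The base component of an element, summed over the cosets of `C`. -/
noncomputable def cosetSum (x : restrictedWreathProduct A Q) : (Q ⧸ C) →₀ Additive A :=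
  Finsupp.mapDomain (QuotientGroup.mk : Q → Q ⧸ C) (toFinsupp x)

/-- A crossed homomorphism law: summing over cosets commutes with translation. -/
theorem cosetSum_mul (x y : restrictedWreathProduct A Q) :
    cosetSum C (x * y) = cosetSum C x + translation A C (rightHom x) (cosetSum C y) := by
  rw [cosetSum, toFinsupp_mul, Finsupp.mapDomain_add, translation_apply, cosetSum, cosetSum,
    ← Finsupp.mapDomain_comp, ← Finsupp.mapDomain_comp]
  rfl

theorem cosetSum_one : cosetSum C (1 : restrictedWreathProduct A Q) = 0 := by
  have h := cosetSum_mul C (1 : restrictedWreathProduct A Q) 1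
  rw [mul_one, map_one, map_one] at h
  simpa using h

theorem cosetSum_inv (x : restrictedWreathProduct A Q) :
    cosetSum C x⁻¹ = -translation A C (rightHom x)⁻¹ (cosetSum C x) := by
  have h := cosetSum_mul C x⁻¹ x
  rw [inv_mul_cancel, cosetSum_one, map_inv] at h
  exact eq_neg_of_add_eq_zero_left h.symm

theorem cosetSum_inv_mul (x y : restrictedWreathProduct A Q) :
    cosetSum C (x⁻¹ * y) = translation A C (rightHom x)⁻¹ (cosetSum C y - cosetSum C x) := by
  rw [cosetSum_mul, cosetSum_inv, map_inv (rightHom (A := A) (Q := Q)), map_sub, neg_add_eq_sub]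

end CommGroup

end restrictedWreathProduct

namespace restrictedWreathProduct

variable {A Q : Type*} [CommGroup A] [CommGroup Q]

/-- If `T ⊔ C` has finite index in `Q`, then the finitely supported functions on `Q ⧸ C` form a
finitely generated `ℤ[T]`-module. -/
theorem exists_finite_generating_translation [hA : Group.FG A] (T C : Subgroup Q)
    [(T ⊔ C).FiniteIndex] :
    ∃ s : Set ((Q ⧸ C) →₀ Additive A), s.Finite ∧ ∀ W : AddSubgroup ((Q ⧸ C) →₀ Additive A),
      (∀ t ∈ T, ∀ w ∈ W, translation A C t w ∈ W) → s ⊆ W → W = ⊤ := by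
  obtain ⟨X, hX, hXfin⟩ := Group.fg_iff.1 hA
  let R : Set Q := Set.range (Quotient.out : Q ⧸ (T ⊔ C) → Q)
  have hfin : Finite (Q ⧸ (T ⊔ C)) := Subgroup.finite_quotient_of_finiteIndex
  have hR : R.Finite := @Set.finite_range _ _ _ hfin
  refine ⟨Set.image2 (fun (r : Q) a => Finsupp.single (r : Q ⧸ C) (Additive.ofMul a)) R X,
    hR.image2 _ hXfin, fun W hW hs => ?_⟩
  have hrep : ∀ r ∈ R, ∀ a : A, Finsupp.single (r : Q ⧸ C) (Additive.ofMul a) ∈ W := by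
    intro r hr a
    have ha : a ∈ Subgroup.closure X := hX ▸ Subgroup.mem_top a
    induction ha using Subgroup.closure_induction with
    | mem x hx => exact hs ⟨r, hr, x, hx, rfl⟩
    | one => rw [ofMul_one, Finsupp.single_zero]; exact W.zero_mem
    | mul x y _ _ hx hy => rw [ofMul_mul, Finsupp.single_add]; exact W.add_mem hx hy
    | inv x _ hx => rw [ofMul_inv, Finsupp.single_neg]; exact W.neg_mem hx
  rw [eq_top_iff]
  intro v _
  induction v using Finsupp.induction_linear with
  | zero => exact W.zero_mem
  | add f g hf hg => exact W.add_mem (hf trivial) (hg trivial)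
  | single p b =>
    obtain ⟨q, rfl⟩ := QuotientGroup.mk_surjective p
    obtain ⟨h, hh⟩ := QuotientGroup.mk_out_eq_mul (T ⊔ C) q
    obtain ⟨t, ht, c, hc, htc⟩ := Subgroup.mem_sup.1 h.2
    -- The `T`-orbits on `Q ⧸ C` correspond to `Q ⧸ (T ⊔ C)`: the chosen representative is `q * (t *
    -- c)`, and `t⁻¹` moves its coset to that of `q`.
    have hmem := hW _ (T.inv_mem ht) _
      (hrep (Quotient.out (q : Q ⧸ (T ⊔ C))) ⟨_, rfl⟩ (Additive.toMul b))
    rw [translation_apply, Finsupp.mapDomain_single, hh, ← htc] at hmem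
    have : t⁻¹ • ((q * (t * c) : Q) : Q ⧸ C) = (q : Q ⧸ C) := by
      rw [MulAction.Quotient.smul_mk, smul_eq_mul, QuotientGroup.eq]
      have : (t⁻¹ * (q * (t * c)))⁻¹ * q = c⁻¹ := by
        rw [mul_left_comm q, inv_mul_cancel_left, mul_inv, mul_comm q⁻¹, inv_mul_cancel_right]
      rw [this]
      exact C.inv_mem hc
    rw [this] at hmem
    exact hmem

/-! ### The finite-index overgroup -/

section Thickening

variable (S : Subgroup (restrictedWreathProduct A Q)) (C : Subgroup Q)
  (L : AddSubgroup ((Q ⧸ C) →₀ Additive A))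
  (hL : ∀ t ∈ S.map rightHom, ∀ w ∈ L, translation A C t w ∈ L)

theorem translation_rightHom_eq {x s : restrictedWreathProduct A Q} {c : Q} (hc : c ∈ C)
    (h : rightHom x = rightHom s * c) :
    translation A C (rightHom x) = translation A C (rightHom s) := by
  rw [h, map_mul, translation_of_mem C hc, mul_one]

theorem translation_rightHom_inv_eq {x s : restrictedWreathProduct A Q} {c : Q} (hc : c ∈ C)
    (h : rightHom x = rightHom s * c) :
    translation A C (rightHom x)⁻¹ = translation A C (rightHom s)⁻¹ := by
  rw [h, mul_inv, map_mul, translation_of_mem C (C.inv_mem hc), mul_one]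

/-- The subgroup of the elements that agree with an element of `S`, up to `C` in the acting group
and up to `L` after summing the base component over the cosets of `C`. -/
def thickening : Subgroup (restrictedWreathProduct A Q) where
  carrier := {x | ∃ s ∈ S, ∃ c ∈ C, rightHom x = rightHom s * c ∧ cosetSum C x - cosetSum C s ∈ L}
  one_mem' := ⟨1, S.one_mem, 1, C.one_mem, by simp, by simp⟩
  mul_mem' := by
    rintro x y ⟨s, hs, c, hc, hx, hxL⟩ ⟨s', hs', c', hc', hy, hyL⟩
    refine ⟨s * s', S.mul_mem hs hs', c * c', C.mul_mem hc hc', ?_, ?_⟩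
    · rw [map_mul, map_mul, hx, hy, mul_mul_mul_comm]
    · rw [cosetSum_mul, cosetSum_mul, translation_rightHom_eq C hc hx, add_sub_add_comm, ← map_sub]
      exact L.add_mem hxL (hL _ ⟨s, hs, rfl⟩ _ hyL)
  inv_mem' := by
    rintro x ⟨s, hs, c, hc, hx, hxL⟩
    refine ⟨s⁻¹, S.inv_mem hs, c⁻¹, C.inv_mem hc, ?_, ?_⟩
    · rw [map_inv, map_inv, hx, mul_inv]
    · rw [cosetSum_inv, cosetSum_inv, translation_rightHom_inv_eq C hc hx, ← neg_sub', ← map_sub]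
      exact L.neg_mem (hL _ (inv_mem ⟨s, hs, rfl⟩) _ hxL)

theorem le_thickening : S ≤ thickening S C L hL :=
  fun s hs => ⟨s, hs, 1, C.one_mem, by simp, by simp⟩

/-- Used to show that the discrepancy of coset sums modulo `L` determines the left coset of the
thickening. -/
theorem inv_mul_mem_thickening {x y s s' : restrictedWreathProduct A Q} (hs : s ∈ S) (hs' : s' ∈ S)
    {c c' : Q} (hc : c ∈ C) (hc' : c' ∈ C) (hx : rightHom x = rightHom s * c)
    (hy : rightHom y = rightHom s' * c')
    (h : (cosetSum C y - cosetSum C s') - (cosetSum C x - cosetSum C s) ∈ L) :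
    x⁻¹ * y ∈ thickening S C L hL := by
  refine ⟨s⁻¹ * s', S.mul_mem (S.inv_mem hs) hs', c⁻¹ * c', C.mul_mem (C.inv_mem hc) hc', ?_, ?_⟩
  · rw [map_mul, map_mul, map_inv, map_inv, hx, hy, mul_inv, mul_mul_mul_comm]
  · rw [cosetSum_inv_mul, cosetSum_inv_mul, translation_rightHom_inv_eq C hc hx, ← map_sub,
      sub_sub_sub_comm]
    exact hL _ (inv_mem ⟨s, hs, rfl⟩) _ h

theorem finiteIndex_thickening [hTC : (S.map rightHom ⊔ C).FiniteIndex]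
    [Finite (((Q ⧸ C) →₀ Additive A) ⧸ L)] : (thickening S C L hL).FiniteIndex := by
  set H := thickening S C L hL
  set K := (S.map rightHom ⊔ C).comap (rightHom (A := A)) with hK
  have hHK : H ≤ K := by
    rintro x ⟨s, hs, c, hc, hx, -⟩
    rw [hK, Subgroup.mem_comap, hx]
    exact Subgroup.mul_mem_sup ⟨s, hs, rfl⟩ hc
  have hex : ∀ x : K, ∃ s ∈ S, ∃ c ∈ C, rightHom (x : restrictedWreathProduct A Q) =
      rightHom s * c := by
    intro x
    obtain ⟨_, ⟨s, hs, rfl⟩, c, hc, h⟩ := Subgroup.mem_sup.1 (Subgroup.mem_comap.1 x.2)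
    exact ⟨s, hs, c, hc, h.symm⟩
  choose σ hσ γ hγ h using hex
  have hfin : Finite (K ⧸ H.subgroupOf K) := by
    refine Finite.of_injective (fun p : K ⧸ H.subgroupOf K =>
      ((cosetSum C p.out.1 - cosetSum C (σ p.out) : (Q ⧸ C) →₀ Additive A) :
        ((Q ⧸ C) →₀ Additive A) ⧸ L)) fun p p' hp => ?_
    rw [← QuotientGroup.out_eq' p, ← QuotientGroup.out_eq' p', QuotientGroup.eq,
      Subgroup.mem_subgroupOf]
    refine inv_mul_mem_thickening S C L hL (hσ _) (hσ _) (hγ _) (hγ _) (h _) (h _) ?_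
    rw [sub_eq_neg_add]
    exact QuotientAddGroup.eq.1 hp
  constructor
  -- The index factors through `K`, the preimage of the finite-index subgroup `T ⊔ C`, where `T` is
  -- the projection of `S`.
  rw [← Subgroup.relIndex_mul_index hHK]
  refine mul_ne_zero ?_ (finiteIndex_comap_rightHom _).index_ne_zero
  exact (Subgroup.finiteIndex_of_finite_quotient (H := H.subgroupOf K)).index_ne_zero

end Thickening

/-! ### Separating an element from a finitely generated subgroup -/

/-- The elements of a finitely generated subgroup have their base components supported on a common
finite union of cosets of the projection of the subgroup. -/
theorem exists_finite_support_subset {S : Subgroup (restrictedWreathProduct A Q)} (hS : S.FG) :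
    ∃ E : Set Q, E.Finite ∧ ∀ s ∈ S, ∀ q, s.1.left q ≠ 1 → ∃ e ∈ E, e⁻¹ * q ∈ S.map rightHom := by
  obtain ⟨X, rfl, hX⟩ := (Subgroup.fg_iff S).1 hS
  refine ⟨⋃ x ∈ X, Function.mulSupport x.1.left, hX.biUnion fun x _ => x.2, fun s hs => ?_⟩
  set T := (Subgroup.closure X).map (rightHom (A := A)) with hT
  have hmem : ∀ x ∈ Subgroup.closure X, x.1.right ∈ T := fun x hx => ⟨x, hx, rfl⟩
  induction hs using Subgroup.closure_induction with
  | mem x hx =>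
    intro q hq
    exact ⟨q, Set.mem_biUnion hx hq, by rw [inv_mul_cancel]; exact T.one_mem⟩
  | one => exact fun q hq => absurd rfl hq
  | mul x y hx hy ihx ihy =>
    intro q hq
    by_cases h : x.1.left q = 1
    · obtain ⟨e, he, h'⟩ := ihy (x.1.right⁻¹ * q) fun h' => hq (by simp [h, h'])
      refine ⟨e, he, ?_⟩
      have := T.mul_mem (hmem x hx) h'
      rwa [mul_left_comm, mul_inv_cancel_left] at this
    · exact ihx q h
  | inv x hx ihx =>
    intro q hq
    obtain ⟨e, he, h'⟩ := ihx (x.1.right * q) fun h' => hq (by simp [h'])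
    refine ⟨e, he, ?_⟩
    have := T.mul_mem (T.inv_mem (hmem x hx)) h'
    rwa [mul_left_comm, inv_mul_cancel_left] at this

/-- An element of the base group outside a finitely generated subgroup `S` is excluded by a subgroup
of finite index containing `S`. -/
theorem exists_finiteIndex_notMem_of_rightHom_eq_one [Group.FG A] [Group.FG Q]
    {S : Subgroup (restrictedWreathProduct A Q)} (hS : S.FG) {m : restrictedWreathProduct A Q}
    (hm : m ∉ S) (hm1 : rightHom m = 1) :
    ∃ H : Subgroup (restrictedWreathProduct A Q), S ≤ H ∧ m ∉ H ∧ H.FiniteIndex := by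
  obtain ⟨E₀, hE₀, hsupp₀⟩ := exists_finite_support_subset hS
  set T := S.map (rightHom (A := A)) with hT
  have hTfg : Group.FG T := (Group.fg_iff_subgroup_fg T).2 (hS.map_monoidHom _)
  set E := E₀ ∪ Function.mulSupport m.1.left with hEdef
  have hE : E.Finite := hE₀.union m.2
  set Y : Set Q := {q | ∃ e ∈ E, e⁻¹ * q ∈ T}
  have hsuppS : ∀ s ∈ S, ((toFinsupp s).support : Set Q) ⊆ Y := by
    intro s hs q hq
    obtain ⟨e, he, h⟩ := hsupp₀ s hs q (Finsupp.mem_support_iff.1 hq)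
    exact ⟨e, Or.inl he, h⟩
  have hsuppm : ((toFinsupp m).support : Set Q) ⊆ Y := fun q hq =>
    ⟨q, Or.inr (Finsupp.mem_support_iff.1 hq), by rw [inv_mul_cancel]; exact T.one_mem⟩
  obtain ⟨C, hdisj, hfin, hC⟩ :=
    T.exists_disjoint_finiteIndex_sup (hE.image2 (fun e e' => e⁻¹ * e') hE)
  -- If `p, q ∈ Y` agree modulo `C`, then `e⁻¹ * e' ∈ T ⊔ C`, hence in `T` by the choice of `C`. So
  -- `p⁻¹ * q` lies in both `T` and `C` and is trivial.
  have hinj : Set.InjOn (QuotientGroup.mk : Q → Q ⧸ C) Y := by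
    rintro p ⟨e, he, hp⟩ q ⟨e', he', hq⟩ hpq
    have hpqC : p⁻¹ * q ∈ C := QuotientGroup.eq.1 hpq
    have key : e⁻¹ * e' = (e⁻¹ * p) * (e'⁻¹ * q)⁻¹ * (p⁻¹ * q) := by
      rw [mul_inv, inv_inv, mul_mul_mul_comm, inv_mul_cancel_right, mul_inv_cancel_right]
    have hee : e⁻¹ * e' ∈ T := by
      refine hC _ ⟨e, he, e', he', rfl⟩ ?_
      rw [key]
      exact Subgroup.mul_mem_sup (T.mul_mem hp (T.inv_mem hq)) hpqC
    have hpqT : p⁻¹ * q ∈ T := by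
      rwa [key, T.mul_mem_cancel_left (T.mul_mem hp (T.inv_mem hq))] at hee
    exact inv_mul_eq_one.1 (Subgroup.disjoint_def.1 hdisj hpqT hpqC)
  let N : AddSubgroup ((Q ⧸ C) →₀ Additive A) :=
    { carrier := {v | ∃ s ∈ S, rightHom s = 1 ∧ cosetSum C s = v}
      zero_mem' := ⟨1, S.one_mem, map_one _, cosetSum_one C⟩
      add_mem' := by
        rintro _ _ ⟨s, hs, hs1, rfl⟩ ⟨s', hs', hs1', rfl⟩
        exact ⟨s * s', S.mul_mem hs hs', by rw [map_mul, hs1, hs1', one_mul],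
          by simp [cosetSum_mul, hs1]⟩
      neg_mem' := by
        rintro _ ⟨s, hs, hs1, rfl⟩
        exact ⟨s⁻¹, S.inv_mem hs, by rw [map_inv, hs1, inv_one], by simp [cosetSum_inv, hs1]⟩ }
  have hN : ∀ t : T, ∀ w ∈ N, (translation A C).comp T.subtype t w ∈ N := by
    rintro ⟨_, u, hu, rfl⟩ _ ⟨s, hs, hs1, rfl⟩
    -- Conjugating a base element by `u` translates its coset sum by the projection of `u`.
    refine ⟨u * s * u⁻¹, S.mul_mem (S.mul_mem hu hs) (S.inv_mem hu), by simp [hs1], ?_⟩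
    simp only [cosetSum_mul, cosetSum_inv, map_mul, hs1, mul_one, map_neg]
    rw [← Module.End.mul_apply (translation A C (rightHom u)), ← map_mul, mul_inv_cancel, map_one]
    simp
  have hmN : cosetSum C m ∉ N := by
    rintro ⟨s, hs, hs1, h⟩
    have := Finsupp.mapDomain_injOn Y hinj (hsuppS s hs) hsuppm h
    rw [ext_toFinsupp this (hs1.trans hm1.symm)] at hs
    exact hm hs
  obtain ⟨s, hsfin, hsgen⟩ := exists_finite_generating_translation (A := A) T C
  obtain ⟨L, hNL, hmL, hLfin, hL⟩ := Representation.exists_invariant_finiteIndex_notMem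
    ((translation A C).comp T.subtype) hsfin
    (fun W hW => hsgen W fun t ht => hW ⟨t, ht⟩) N hN hmN
  refine ⟨thickening S C L fun t ht => hL ⟨t, ht⟩, le_thickening _ _ _ _, ?_,
    finiteIndex_thickening _ _ _ _⟩
  rintro ⟨u, hu, c, hc, huc, huL⟩
  rw [hm1] at huc
  -- `c` is inverse to an element of `T`, so `c = 1`. Hence `u` lies in the base group and its coset
  -- sum is in `N ≤ L`, which would put that of `m` in `L`.
  have hcT : c ∈ T := by
    rw [eq_inv_of_mul_eq_one_right huc.symm]
    exact T.inv_mem ⟨u, hu, rfl⟩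
  rw [Subgroup.disjoint_def.1 hdisj hcT hc, mul_one] at huc
  have := L.add_mem huL (hNL ⟨u, hu, huc.symm, rfl⟩)
  rw [sub_add_cancel] at this
  exact hmL this

theorem isSeparableSubgroup_of_fg [Group.FG A] [Group.FG Q]
    {S : Subgroup (restrictedWreathProduct A Q)} (hS : S.FG) : IsSeparableSubgroup S := by
  refine .of_forall_notMem fun g hg => ?_
  by_cases hgT : rightHom g ∈ S.map rightHom
  · obtain ⟨s, hs, hsg⟩ := hgT
    obtain ⟨H, hSH, hH, hfin⟩ := exists_finiteIndex_notMem_of_rightHom_eq_one hS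
      (m := g * s⁻¹) (by rwa [S.mul_mem_cancel_right (S.inv_mem hs)]) (by simp [hsg])
    exact ⟨H, hSH, fun h => hH (H.mul_mem h (H.inv_mem (hSH hs))), hfin⟩
  · obtain ⟨U, hTU, hgU, hU⟩ := Subgroup.exists_finiteIndex_notMem _ hgT
    exact ⟨U.comap rightHom, Subgroup.map_le_iff_le_comap.1 hTU, hgU,
      finiteIndex_comap_rightHom U⟩

end restrictedWreathProduct

theorem mainTheorem1 (A Q : Type*) [CommGroup A] [CommGroup Q]
    (hA : Group.FG A) (hQ : Group.FG Q) :
    IsLERF (restrictedWreathProduct A Q) :=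
  ⟨restrictedWreathProduct.fg, fun _ hS => restrictedWreathProduct.isSeparableSubgroup_of_fg hS⟩
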